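/- Let $d\ge 2$. Let $\mathcal S_{d^2}$ be the set of real $d^2\times d^2$ (row-)stochastic matrices, i.e. matrices with nonnegative entries all of whose rows sum to $1$, and let $\mathcal T_d$ be the set of quantum channels on $\mathcal M_d=\mathbb C^{d\times d}$, i.e. of completely positive trace-preserving linear maps $\mathcal M_d\to\mathcal M_d$. For a set $\mathcal G$ of linear maps on a finite-dimensional space (the generators) let $\mathcal I_{\mathcal G}$ be the set of all $T$ such that for every $\varepsilon>0$ there are finitely many $G_1,\dots,G_n\in\mathcal G$ with $\|e^{G_j}-\mathrm{id}\|\le\varepsilon$ for all $j$ and $\prod_{j=1}^n e^{G_j}=T$; elements of the closure $\overline{\mathcal I}_{\mathcal G}$ are called infinitesimal Markovian divisible with respect to $\mathcal G$. For stochastic matrices in $\mathcal S_{d^2}$, $\mathcal G$ is taken to be the set of transition rate matrices $Q\in\mathbb R^{d^2\times d^2}$ ($Q_{ij}\ge 0$ for $i\ne j$, and $\sum_j Q_{ij}=0$ for every $i$). For quantum channels, $\mathcal G$ is taken to be the set of Lindblad generators $$L(\rho)=i[\rho,H]+\sum_{j=1}^m\Big(L_j\rho L_j^\dagger-\tfrac12\{L_j^\dagger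 L_j,\rho\}\Big),\qquad H=H^\dagger,\ L_j\in\mathcal M_d,\ m\in\mathbb N.$$ Then there is no map $f:\mathcal S_{d^2}\to\mathcal T_d$ with both of the following properties: 1. for every $S\in\mathcal S_{d^2}$, if $S$ is infinitesimal Markovian divisible, then so is the channel $f(S)$; 2. for every $S\in\mathcal S_{d^2}$, the singular values of $f(S)$, counted with multiplicity, are those of $S$, where the singular values of a linear map on $\mathcal M_d$ are taken with respect to the Hilbert–Schmidt inner product $\langle A,B\rangle=\operatorname{Tr}(A^\dagger B)$. -/

import Mathlib

open scoped Matrix Kronecker ComplexOrder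

noncomputable section

namespace MarkovDiv

/-- `𝓘_𝒢` for a set `𝒢` of square matrices (the generators): the matrices which, for every
`ε > 0`, are a finite product of exponentials `e^G` with `G ∈ 𝒢` and `‖e^G - 1‖ ≤ ε`. The norm is
the Euclidean operator norm; since `ε` is arbitrary, the choice of norm does not matter. -/
def infinitesimalProducts {𝕜 : Type*} [RCLike 𝕜] {n : Type*} [Fintype n] [DecidableEq n]
    (𝒢 : Set (Matrix n n 𝕜)) : Set (Matrix n n 𝕜) :=
  {T | ∀ ε : ℝ, 0 < ε → ∃ l : List (Matrix n n 𝕜),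
    (∀ G ∈ l, G ∈ 𝒢 ∧ ‖Matrix.toEuclideanCLM (n := n) (𝕜 := 𝕜) (NormedSpace.exp G - 1)‖ ≤ ε) ∧
    (l.map NormedSpace.exp).prod = T}

/-- The matrix `T` is infinitesimal Markovian divisible with respect to the set of generators `𝒢`:
it belongs to the closure of `𝓘_𝒢`. -/
def IsInfinitesimalMarkovianDivisible {𝕜 : Type*} [RCLike 𝕜] {n : Type*} [Fintype n]
    [DecidableEq n] (𝒢 : Set (Matrix n n 𝕜)) (T : Matrix n n 𝕜) : Prop :=
  T ∈ closure (infinitesimalProducts 𝒢)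

/-- The singular values of a square matrix: in decreasing order, with multiplicity, followed by
zeros. -/
def matrixSingularValues {𝕜 : Type*} [RCLike 𝕜] {n : Type*} [Fintype n] [DecidableEq n]
    (A : Matrix n n 𝕜) : ℕ →₀ ℝ :=
  (Matrix.toEuclideanLin A).singularValues

/-- The `d × d` transition rate matrices: nonnegative off-diagonal entries, rows summing to `0`. -/
def transitionRateMatrices (n : Type*) [Fintype n] : Set (Matrix n n ℝ) :=
  {Q | (∀ i j, i ≠ j → 0 ≤ Q i j) ∧ ∀ i, ∑ j, Q i j = 0}

/-- Linear maps on `d × d` complex matrices. -/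
abbrev SuperOp (d : ℕ) : Type :=
  Matrix (Fin d) (Fin d) ℂ →ₗ[ℂ] Matrix (Fin d) (Fin d) ℂ

/-- The map `T ⊗ id` on `M_d ⊗ M_n`, the latter identified with the matrices indexed by
`Fin d × Fin n`. -/
def ampliation {d : ℕ} (T : SuperOp d) (n : ℕ)
    (X : Matrix (Fin d × Fin n) (Fin d × Fin n) ℂ) :
    Matrix (Fin d × Fin n) (Fin d × Fin n) ℂ :=
  Matrix.of fun p q => T (Matrix.of fun i j => X (i, p.2) (j, q.2)) p.1 q.1

theorem ampliation_kronecker {d : ℕ} (T : SuperOp d) (n : ℕ) (A : Matrix (Fin d) (Fin d) ℂ)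
    (B : Matrix (Fin n) (Fin n) ℂ) : ampliation T n (A ⊗ₖ B) = T A ⊗ₖ B := by
  ext p q
  have h : (Matrix.of fun i j => A i j * B p.2 q.2) = B p.2 q.2 • A := by
    ext i j
    simp [mul_comm]
  simp [ampliation, h, mul_comm]

/-- Complete positivity: `T ⊗ id` preserves positive semidefiniteness for every `n`. -/
def IsCompletelyPositive {d : ℕ} (T : SuperOp d) : Prop :=
  ∀ (n : ℕ) (X : Matrix (Fin d × Fin n) (Fin d × Fin n) ℂ),
    X.PosSemidef → (ampliation T n X).PosSemidef

/-- Quantum channels on `M_d`: linear, completely positive, trace-preserving maps. -/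
structure IsQuantumChannel {d : ℕ} (T : SuperOp d) : Prop where
  completelyPositive : IsCompletelyPositive T
  trace_apply : ∀ ρ, (T ρ).trace = ρ.trace

/-- The set of quantum channels on `M_d`. -/
def quantumChannels (d : ℕ) : Set (SuperOp d) := {T | IsQuantumChannel T}

/-- Lindblad (GKLS) generators:
`L(ρ) = i[ρ, H] + ∑ⱼ (Kⱼ ρ Kⱼ† - ½ {Kⱼ† Kⱼ, ρ})` with `H` Hermitian. -/
def IsLindbladGenerator {d : ℕ} (L : SuperOp d) : Prop :=
  ∃ H : Matrix (Fin d) (Fin d) ℂ, H.IsHermitian ∧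
  ∃ (m : ℕ) (K : Fin m → Matrix (Fin d) (Fin d) ℂ), ∀ ρ,
    L ρ = Complex.I • (ρ * H - H * ρ) +
      ∑ j, (K j * ρ * (K j)ᴴ - (1 / 2 : ℂ) • ((K j)ᴴ * K j * ρ + ρ * ((K j)ᴴ * K j)))

/-- The `d² × d²` matrix of a linear map on `M_d` in the basis of matrix units, which is
orthonormal for the Hilbert–Schmidt inner product `⟨A, B⟩ = Tr(A† B)`. -/
def superOpMatrix {d : ℕ} (T : SuperOp d) : Matrix (Fin d × Fin d) (Fin d × Fin d) ℂ :=
  LinearMap.toMatrix (Matrix.stdBasis ℂ (Fin d) (Fin d)) (Matrix.stdBasis ℂ (Fin d) (Fin d)) T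

/-- The singular values of a linear map on `M_d`, with `M_d` carrying the Hilbert–Schmidt inner
product. -/
def superOpSingularValues {d : ℕ} (T : SuperOp d) : ℕ →₀ ℝ :=
  matrixSingularValues (superOpMatrix T)

/-- Infinitesimal Markovian divisibility of a stochastic matrix: the generators are the transition
rate matrices. -/
def IsInfinitesimalDivisibleStochastic {n : Type*} [Fintype n] [DecidableEq n]
    (S : Matrix n n ℝ) : Prop :=
  IsInfinitesimalMarkovianDivisible (transitionRateMatrices n) S

/-- Infinitesimal Markovian divisibility of a quantum channel: the generators are the Lindblad
generators. -/
def IsInfinitesimalDivisibleChannel {d : ℕ} (T : SuperOp d) : Prop :=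
  IsInfinitesimalMarkovianDivisible (superOpMatrix '' {L : SuperOp d | IsLindbladGenerator L})
    (superOpMatrix T)

end MarkovDiv

end

/-!
The obstruction is an inequality between the determinant and the smallest singular value. An
infinitesimal Markovian divisible channel `T` on `M_d`, `d ≥ 2`, satisfies
`‖T X‖ ≥ |det T| ‖X‖` for every `X` (`IsInfinitesimalDivisibleChannel.detLeMinStretch`): its
smallest singular value is at least the product of all its singular values. This is a property of
the singular values alone (`detLeMinStretch_iff`), and some infinitesimal Markovian divisible
stochastic matrices violate it (`not_detLeMinStretch_halfJump`).

For channels, the inequality is stable under products and limits, so that it suffices to prove it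
for `e^L` with `L` a Lindblad generator. There `|det e^L| = e^(Re tr L)` (`det_exp`), while
`‖e^L X‖ ≥ e^c ‖X‖` as soon as `Re ⟨X, L X⟩ ≥ c ‖X‖²` for all `X`
(`exp_mul_norm_le_norm_exp_apply`). So the claim is `Re ⟨X, L X⟩ ≥ Re (tr L) ‖X‖²`. The Hamiltonian
part contributes to neither side. For the dissipator of a jump operator `K`, both sides are
unchanged when a multiple of the identity is added to `K`, so that one may take `tr K = 0`; then
the trace of the dissipator is `-d ‖K‖²`, in the Hilbert–Schmidt norm, and its quadratic form is at
least `-2 ‖K‖² ‖X‖²` by submultiplicativity of that norm (`re_trace_dissipator_ge`).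

For stochastic matrices, let `P = E_aa - E_ab`, an idempotent of trace `1`. Then
`e^(-t P) = 1 - (1 - e^(-t)) P` has determinant `e^(-t)`. It maps `e_a` to `e^(-t) e_a`, but `e_a` is
not a right singular vector, so that the smallest singular value is strictly less than `e^(-t)`. The
proof uses `t = log 2`.
-/

namespace MarkovDiv

/-! ### Exponentials of matrices -/

section Exponential

open scoped Matrix.Norms.L2Operator

variable {𝕜 : Type*} [RCLike 𝕜] {n : Type*} [Fintype n] [DecidableEq n]

theorem differentiable_det : Differentiable 𝕜 (Matrix.det : Matrix n n 𝕜 → 𝕜) := by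
  have hentry (i j : n) : Differentiable 𝕜 fun A : Matrix n n 𝕜 => A i j :=
    (LinearMap.toContinuousLinearMap (Matrix.entryLinearMap 𝕜 𝕜 i j)).differentiable
  have h : (Matrix.det : Matrix n n 𝕜 → 𝕜) =
      fun A => ∑ σ : Equiv.Perm n, ((Equiv.Perm.sign σ : ℤ) : 𝕜) * ∏ i, A (σ i) i := by
    ext A
    exact Matrix.det_apply' A
  rw [h]
  fun_prop

/-- Obtained along the line `t ↦ 1 + t A`, on which the determinant is a polynomial in `t`. -/
theorem fderiv_det_one (A : Matrix n n 𝕜) :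
    fderiv 𝕜 (Matrix.det : Matrix n n 𝕜 → 𝕜) 1 A = A.trace := by
  have hpath : HasDerivAt (fun t : 𝕜 => 1 + t • A) A 0 := by
    simpa using ((hasDerivAt_id (0 : 𝕜)).smul_const A).const_add 1
  have h1 : HasDerivAt (fun t : 𝕜 => (1 + t • A).det)
      (fderiv 𝕜 (Matrix.det : Matrix n n 𝕜 → 𝕜) 1 A) 0 := by
    have hd : HasFDerivAt (Matrix.det : Matrix n n 𝕜 → 𝕜)
        (fderiv 𝕜 (Matrix.det : Matrix n n 𝕜 → 𝕜) 1) (1 + (0 : 𝕜) • A) := by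
      simpa using (differentiable_det (1 : Matrix n n 𝕜)).hasFDerivAt
    exact hd.comp_hasDerivAt 0 hpath
  have h2 : HasDerivAt (fun t : 𝕜 => (1 + t • A).det) A.trace 0 := by
    rw [funext fun t : 𝕜 => Matrix.det_one_add_smul t A]
    generalize (1 + (Polynomial.X : Polynomial 𝕜) • A.map Polynomial.C).det.divX.divX = p
    have := (((hasDerivAt_id (0 : 𝕜)).const_mul A.trace).const_add 1).add
      ((p.hasDerivAt 0).mul (hasDerivAt_pow 2 (0 : 𝕜)))
    refine HasDerivAt.congr_deriv this ?_
    simp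
  exact h1.unique h2

/-- Jacobi's formula `det e^A = e^(tr A)`. -/
theorem det_exp (A : Matrix n n 𝕜) :
    (NormedSpace.exp A).det = NormedSpace.exp A.trace := by
  -- `t ↦ det e^(tA)` is multiplicative, so that its derivative at `0` determines it.
  let g : 𝕜 → 𝕜 := fun t => (NormedSpace.exp (t • A)).det
  have hg0 : HasDerivAt g A.trace 0 := by
    have he : HasDerivAt (fun t : 𝕜 => NormedSpace.exp (t • A)) A 0 := by
      simpa using hasDerivAt_exp_smul_const (𝕂 := 𝕜) A 0
    have hd : HasFDerivAt (Matrix.det : Matrix n n 𝕜 → 𝕜)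
        (fderiv 𝕜 (Matrix.det : Matrix n n 𝕜 → 𝕜) 1) (NormedSpace.exp ((0 : 𝕜) • A)) := by
      simpa using (differentiable_det (1 : Matrix n n 𝕜)).hasFDerivAt
    rw [← fderiv_det_one A]
    exact hd.comp_hasDerivAt 0 he
  have hadd (t s : 𝕜) : g (t + s) = g t * g s := by
    simp only [g, add_smul]
    rw [Matrix.exp_add_of_commute _ _ (((Commute.refl A).smul_left t).smul_right s),
      Matrix.det_mul]
  have hg (t : 𝕜) : HasDerivAt g (g t * A.trace) t := by
    have h : HasDerivAt (fun s => g t * g (s - t)) (g t * A.trace) t := by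
      have := HasDerivAt.comp_sub_const t t (by simpa using hg0)
      exact this.const_mul _
    refine h.congr_of_eventuallyEq (Filter.Eventually.of_forall fun s => ?_)
    simp [← hadd]
  have he (t : 𝕜) : HasDerivAt (fun s : 𝕜 => NormedSpace.exp (s • -A.trace))
      (NormedSpace.exp (t • -A.trace) * -A.trace) t := hasDerivAt_exp_smul_const _ t
  have hconst (t : 𝕜) : HasDerivAt (fun s => g s * NormedSpace.exp (s • -A.trace)) 0 t := by
    have h := (hg t).mul (he t)
    rwa [show g t * A.trace * NormedSpace.exp (t • -A.trace) +
      g t * (NormedSpace.exp (t • -A.trace) * -A.trace) = 0 by ring] at h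
  have := is_const_of_deriv_eq_zero (fun t => (hconst t).differentiableAt)
    (fun t => (hconst t).deriv) 1 0
  simp only [g, one_smul, zero_smul, NormedSpace.exp_zero, Matrix.det_one, mul_one] at this
  have hinv : NormedSpace.exp (-A.trace) * NormedSpace.exp A.trace = 1 := by
    rw [← NormedSpace.exp_add_of_commute ((Commute.refl A.trace).neg_left)]
    simp
  calc (NormedSpace.exp A).det
      = (NormedSpace.exp A).det * (NormedSpace.exp (-A.trace) * NormedSpace.exp A.trace) := by
        rw [hinv, mul_one]
    _ = NormedSpace.exp A.trace := by rw [← mul_assoc, this, one_mul]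

theorem exp_smul_of_isIdempotentElem {P : Matrix n n 𝕜} (hP : IsIdempotentElem P) (c : 𝕜) :
    NormedSpace.exp (c • P) = 1 + (NormedSpace.exp c - 1) • P := by
  have h1 : HasSum (fun k : ℕ => ((k.factorial : 𝕜)⁻¹) • (c • P) ^ k)
      (NormedSpace.exp (c • P)) := NormedSpace.exp_series_hasSum_exp' (𝕂 := 𝕜) _
  have h2 : HasSum (fun k : ℕ => ((k.factorial : 𝕜)⁻¹) • c ^ k) (NormedSpace.exp c) :=
    NormedSpace.exp_series_hasSum_exp' (𝕂 := 𝕜) c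
  have h3 := (h2.smul_const P).add (hasSum_ite_eq 0 (1 - P))
  have hterm : (fun k : ℕ => ((k.factorial : 𝕜)⁻¹) • (c • P) ^ k) =
      fun k => (((k.factorial : 𝕜)⁻¹) • c ^ k) • P + if k = 0 then 1 - P else 0 := by
    ext1 k
    rcases Nat.eq_zero_or_pos k with rfl | hk
    · simp
    · simp [hk.ne', smul_pow, hP.pow_eq hk.ne', smul_smul]
  rw [hterm] at h1
  rw [h1.unique h3]
  module

end Exponential

/-! ### Lower bounds for the exponential of an operator -/

section Dissipation

/-- If the symmetric part of `A` is bounded below by `c`, then `e^A` shrinks no vector by more than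
the factor `e^c`. -/
theorem exp_mul_norm_le_norm_exp_apply {E : Type*} [NormedAddCommGroup E] [InnerProductSpace ℂ E]
    [CompleteSpace E] (A : E →L[ℂ] E) (c : ℝ)
    (h : ∀ v, c * ‖v‖ ^ 2 ≤ (inner ℂ v (A v)).re) (v : E) :
    Real.exp c * ‖v‖ ≤ ‖NormedSpace.exp A v‖ := by
  let : InnerProductSpace ℝ E := InnerProductSpace.rclikeToReal ℂ E
  let y : ℝ → E := fun t => NormedSpace.exp (t • A) v
  have hy (t : ℝ) : HasDerivAt y (A (y t)) t := by
    have h1 : HasDerivAt (fun t : ℝ => NormedSpace.exp (t • A)) (A * NormedSpace.exp (t • A)) t :=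
      hasDerivAt_exp_smul_const' A t
    let ev : (E →L[ℂ] E) →L[ℝ] E := (ContinuousLinearMap.apply ℂ E v).restrictScalars ℝ
    exact ev.hasFDerivAt.comp_hasDerivAt t h1
  have hn (t : ℝ) : HasDerivAt (fun t => ‖y t‖ ^ 2) (2 * (inner ℂ (y t) (A (y t))).re) t :=
    (hy t).norm_sq
  have he (t : ℝ) : HasDerivAt (fun t => Real.exp (-(2 * c) * t))
      (Real.exp (-(2 * c) * t) * -(2 * c)) t := by
    simpa using ((hasDerivAt_id t).const_mul (-(2 * c))).exp
  -- The bound says that `‖y t‖²` grows at least at the rate `2 c`.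
  have hmono : Monotone fun t => Real.exp (-(2 * c) * t) * ‖y t‖ ^ 2 := by
    refine monotone_of_hasDerivAt_nonneg (fun t => (he t).mul (hn t)) fun t => ?_
    have := mul_nonneg (Real.exp_nonneg (-(2 * c) * t)) (sub_nonneg.mpr (h (y t)))
    simp only [Pi.zero_apply]
    linarith
  have h01 := hmono zero_le_one
  simp only [y, mul_zero, Real.exp_zero, zero_smul, NormedSpace.exp_zero, one_mul, mul_one,
    one_smul, one_apply_eq_self] at h01
  have hsq : (Real.exp c * ‖v‖) ^ 2 ≤ ‖NormedSpace.exp A v‖ ^ 2 := by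
    have hexp : Real.exp c ^ 2 * Real.exp (-(2 * c)) = 1 := by
      rw [← Real.exp_nat_mul, ← Real.exp_add]
      simp
    calc (Real.exp c * ‖v‖) ^ 2 = Real.exp c ^ 2 * ‖v‖ ^ 2 := mul_pow _ _ _
      _ ≤ Real.exp c ^ 2 * (Real.exp (-(2 * c)) * ‖NormedSpace.exp A v‖ ^ 2) := by gcongr
      _ = ‖NormedSpace.exp A v‖ ^ 2 := by rw [← mul_assoc, hexp, one_mul]
  exact le_of_sq_le_sq hsq (norm_nonneg _)

end Dissipation

/-! ### Determinant and smallest singular value -/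

section MinSingularValue

variable {𝕜 : Type*} [RCLike 𝕜] {n : Type*} [Fintype n] [DecidableEq n]

/-- The modulus of the determinant of `T` bounds its smallest singular value from below. The latter
is encoded as the smallest factor by which `T` stretches a vector, which makes the property visibly
multiplicative and closed. -/
def DetLeMinStretch (T : Matrix n n 𝕜) : Prop :=
  ∀ v : EuclideanSpace 𝕜 n, ‖T.det‖ * ‖v‖ ≤ ‖Matrix.toEuclideanLin T v‖

theorem DetLeMinStretch.mul {S T : Matrix n n 𝕜} (hS : DetLeMinStretch S)
    (hT : DetLeMinStretch T) : DetLeMinStretch (S * T) := by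
  intro v
  have hmul : Matrix.toEuclideanLin (S * T) v =
      Matrix.toEuclideanLin S (Matrix.toEuclideanLin T v) := by
    simp [Matrix.toLpLin_apply]
  rw [hmul, Matrix.det_mul, norm_mul, mul_assoc]
  exact (mul_le_mul_of_nonneg_left (hT v) (norm_nonneg _)).trans (hS _)

theorem detLeMinStretch_list_prod (l : List (Matrix n n 𝕜)) (h : ∀ T ∈ l, DetLeMinStretch T) :
    DetLeMinStretch l.prod := by
  induction l with
  | nil => intro v; simp
  | cons T l ih =>
    rw [List.prod_cons]
    exact (h T (by simp)).mul (ih fun S hS => h S (by simp [hS]))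

theorem isClosed_setOf_detLeMinStretch :
    IsClosed {T : Matrix n n 𝕜 | DetLeMinStretch T} := by
  simp only [DetLeMinStretch, Set.ofPred_forall, Matrix.toLpLin_apply]
  refine isClosed_iInter fun v => isClosed_le ?_ ?_
  · exact (continuous_id.matrix_det.norm).mul continuous_const
  · exact ((PiLp.continuous_toLp 2 _).comp
      (continuous_id.matrix_mulVec continuous_const)).norm

/-- The singular values are the stretch factors of an orthonormal basis of eigenvectors of `T† T`;
the smallest of them is the smallest stretch factor of all. -/
theorem forall_mul_norm_le_iff_le_singularValues {E : Type*} [NormedAddCommGroup E]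
    [InnerProductSpace 𝕜 E] [FiniteDimensional 𝕜 E] (T : E →ₗ[𝕜] E) {c : ℝ} (hc : 0 ≤ c) :
    (∀ v, c * ‖v‖ ≤ ‖T v‖) ↔ ∀ i < Module.finrank 𝕜 E, c ≤ T.singularValues i := by
  have hsq (v : E) : ‖T v‖ ^ 2 = RCLike.re (inner 𝕜 v ((LinearMap.adjoint T ∘ₗ T) v)) := by
    rw [LinearMap.comp_apply, LinearMap.adjoint_inner_right, inner_self_eq_norm_sq]
  set b := T.isSymmetric_adjoint_comp_self.eigenvectorBasis rfl
  have hb (i) : (LinearMap.adjoint T ∘ₗ T) (b i) = ((T.singularValues i ^ 2 : ℝ) : 𝕜) • b i := by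
    rw [T.sq_singularValues_fin rfl]
    exact T.isSymmetric_adjoint_comp_self.apply_eigenvectorBasis rfl i
  constructor
  · intro h i hi
    have h1 := h (b ⟨i, hi⟩)
    have h2 := hsq (b ⟨i, hi⟩)
    rw [hb, inner_smul_right, inner_self_eq_norm_sq_to_K, b.norm_eq_one] at h2
    rw [b.norm_eq_one, mul_one] at h1
    have h3 : ‖T (b ⟨i, hi⟩)‖ ^ 2 = T.singularValues i ^ 2 := by
      rw [h2]; norm_cast; simp
    rw [(sq_eq_sq₀ (norm_nonneg _) (T.singularValues_nonneg i)).mp h3] at h1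
    exact h1
  · intro h v
    refine le_of_sq_le_sq ?_ (norm_nonneg _)
    have hv : (LinearMap.adjoint T ∘ₗ T) v =
        ∑ i, (b.repr v i * ((T.singularValues i ^ 2 : ℝ) : 𝕜)) • b i := by
      conv_lhs => rw [← b.sum_repr v]
      simp_rw [map_sum, map_smul, hb, smul_smul]
    rw [hsq, hv, inner_sum, map_sum, mul_pow, ← b.sum_sq_norm_inner_right v, Finset.mul_sum]
    refine Finset.sum_le_sum fun i _ => ?_
    have hi : inner 𝕜 v ((b.repr v i * ((T.singularValues i ^ 2 : ℝ) : 𝕜)) • b i) =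
        ((T.singularValues i ^ 2 * ‖inner 𝕜 (b i) v‖ ^ 2 : ℝ) : 𝕜) := by
      rw [inner_smul_right, b.repr_apply_apply, mul_right_comm, ← inner_conj_symm v (b i),
        RCLike.mul_conj]
      push_cast
      ring
    rw [hi, RCLike.ofReal_re]
    gcongr
    exact h i i.2

/-- `DetLeMinStretch` depends only on the singular values, so that it can be carried from a complex
matrix to a real one. -/
theorem detLeMinStretch_iff (T : Matrix n n 𝕜) :
    DetLeMinStretch T ↔ ∀ i < Fintype.card n,
      ∏ j ∈ Finset.range (Fintype.card n), matrixSingularValues T j ≤ matrixSingularValues T i := by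
  have hdet : ‖T.det‖ = ∏ j ∈ Finset.range (Fintype.card n), matrixSingularValues T j := by
    have h1 : LinearMap.det (Matrix.toEuclideanLin T) = T.det := by
      rw [Matrix.toEuclideanLin, Matrix.toLpLin_eq_toLin, LinearMap.det_toLin]
    rw [← h1, ← LinearMap.normDet_eq_norm_det, LinearMap.normDet_eq_prod_singularValues,
      finrank_euclideanSpace]
    rfl
  rw [← hdet]
  simpa only [finrank_euclideanSpace, DetLeMinStretch, matrixSingularValues] using
    forall_mul_norm_le_iff_le_singularValues (Matrix.toEuclideanLin T) (norm_nonneg T.det)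

end MinSingularValue

/-! ### The quadratic form of a dissipator -/

section Lindblad

open scoped Matrix.Norms.Frobenius

variable {n : Type*} [Fintype n]

theorem frobenius_norm_sq_eq_re_trace (A : Matrix n n ℂ) :
    ‖A‖ ^ 2 = (Aᴴ * A).trace.re := by
  rw [Matrix.frobenius_norm_def, ← Real.sqrt_eq_rpow, Real.sq_sqrt (by positivity),
    Matrix.trace, Complex.re_sum, Finset.sum_comm]
  refine Finset.sum_congr rfl fun i _ => ?_
  simp only [Matrix.diag_apply, Matrix.mul_apply, Matrix.conjTranspose_apply, Complex.re_sum]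
  refine Finset.sum_congr rfl fun j _ => ?_
  rw [Complex.star_def, mul_comm, Complex.mul_conj, Complex.normSq_eq_norm_sq, Complex.ofReal_re]
  norm_cast

/-- The dissipator `X ↦ K X K† - ½ (K† K X + X K† K)`. -/
noncomputable def dissipator (K X : Matrix n n ℂ) : Matrix n n ℂ :=
  K * X * Kᴴ - (1 / 2 : ℂ) • (Kᴴ * K * X + X * (Kᴴ * K))

theorem re_trace_conjTranspose (A : Matrix n n ℂ) : Aᴴ.trace.re = A.trace.re := by
  simp [Matrix.trace_conjTranspose]

/-- The quadratic form of the dissipator, written through commutators only; it is therefore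
unchanged when a multiple of the identity is added to `K`. -/
theorem two_mul_re_trace_dissipator (K X : Matrix n n ℂ) :
    2 * (Xᴴ * dissipator K X).trace.re =
      ((K * Kᴴ - Kᴴ * K) * (Xᴴ * X)).trace.re - ‖K * X - X * K‖ ^ 2 := by
  rw [frobenius_norm_sq_eq_re_trace, dissipator]
  have h1 : (Xᴴ * (X * (Kᴴ * K))).trace = (Kᴴ * K * (Xᴴ * X)).trace := by
    rw [← mul_assoc, Matrix.trace_mul_comm]
  have h2 : (Kᴴ * (Xᴴ * (X * K))).trace = (K * Kᴴ * (Xᴴ * X)).trace := by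
    rw [← mul_assoc, ← mul_assoc, Matrix.trace_mul_comm]; simp only [mul_assoc]
  have h3 : (Kᴴ * (Xᴴ * (K * X))).trace.re = (Xᴴ * (K * (X * Kᴴ))).trace.re := by
    rw [Matrix.trace_mul_comm]; simp only [mul_assoc]
  have h4 : (Xᴴ * (Kᴴ * (X * K))).trace.re = (Xᴴ * (K * (X * Kᴴ))).trace.re := by
    rw [← h3, ← re_trace_conjTranspose]; simp [mul_assoc]
  simp only [Matrix.conjTranspose_sub, Matrix.conjTranspose_mul, mul_sub, sub_mul, mul_add,
    Matrix.mul_smul, Matrix.trace_sub, Matrix.trace_add, Matrix.trace_smul, Complex.sub_re, h1]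
  simp only [mul_assoc] at *
  have h5 (z : ℂ) : ((1 / 2 : ℂ) • z).re = z.re / 2 := by
    simp [div_eq_inv_mul]
  rw [h5, h2, h3, h4]
  simp only [Complex.add_re]
  ring

variable [DecidableEq n]

theorem re_trace_dissipator_add_smul_one (K X : Matrix n n ℂ) (c : ℂ) :
    (Xᴴ * dissipator (K + c • 1) X).trace.re = (Xᴴ * dissipator K X).trace.re := by
  have h := two_mul_re_trace_dissipator K X
  have h' := two_mul_re_trace_dissipator (K + c • 1) X
  have e1 : (K + c • 1) * (K + c • 1)ᴴ - (K + c • 1)ᴴ * (K + c • 1) = K * Kᴴ - Kᴴ * K := by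
    simp only [Matrix.conjTranspose_add, Matrix.conjTranspose_smul, Matrix.conjTranspose_one,
      add_mul, mul_add, smul_add, smul_mul_assoc, mul_smul_comm, one_mul, mul_one]
    rw [smul_comm c (star c) (1 : Matrix n n ℂ)]
    abel
  have e2 : (K + c • 1) * X - X * (K + c • 1) = K * X - X * K := by
    simp [add_mul, mul_add]
  rw [e1, e2] at h'
  linarith

theorem neg_two_mul_le_re_trace_dissipator (K X : Matrix n n ℂ) :
    -(2 * ‖K‖ ^ 2 * ‖X‖ ^ 2) ≤ (Xᴴ * dissipator K X).trace.re := by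
  have h := two_mul_re_trace_dissipator K X
  have h1 : ((K * Kᴴ - Kᴴ * K) * (Xᴴ * X)).trace.re = ‖X * K‖ ^ 2 - ‖X * Kᴴ‖ ^ 2 := by
    rw [frobenius_norm_sq_eq_re_trace, frobenius_norm_sq_eq_re_trace, sub_mul, Matrix.trace_sub,
      Complex.sub_re, mul_assoc K Kᴴ, Matrix.trace_mul_comm K, mul_assoc Kᴴ K,
      Matrix.trace_mul_comm Kᴴ]
    simp [mul_assoc]
  have h2 : ‖X * Kᴴ‖ ≤ ‖K‖ * ‖X‖ := by
    simpa [Matrix.frobenius_norm_conjTranspose, mul_comm] using Matrix.frobenius_norm_mul X Kᴴ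
  have h3 : ‖X * K‖ ≤ ‖K‖ * ‖X‖ := by
    simpa [mul_comm] using Matrix.frobenius_norm_mul X K
  have h4 : ‖K * X‖ ≤ ‖K‖ * ‖X‖ := Matrix.frobenius_norm_mul K X
  have h5 : ‖K * X - X * K‖ ≤ ‖K * X‖ + ‖X * K‖ := norm_sub_le _ _
  have g2 := pow_le_pow_left₀ (norm_nonneg _) h2 2
  have g3 := pow_le_pow_left₀ (norm_nonneg _) h3 2
  have g4 := pow_le_pow_left₀ (norm_nonneg _) h4 2
  have g5 := pow_le_pow_left₀ (norm_nonneg _) h5 2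
  nlinarith [sq_nonneg (‖K * X‖ - ‖X * K‖)]

/-- The trace of a dissipator, up to sign, through the traceless part of `K`. -/
theorem card_mul_norm_sub_smul_one_sq (K : Matrix n n ℂ) [Nonempty n] :
    Fintype.card n * ‖K - (K.trace / Fintype.card n) • (1 : Matrix n n ℂ)‖ ^ 2 =
      Fintype.card n * ‖K‖ ^ 2 - ‖K.trace‖ ^ 2 := by
  have hn : (Fintype.card n : ℂ) ≠ 0 := by simp
  have key : (Fintype.card n : ℂ) * ((K - (K.trace / Fintype.card n) • (1 : Matrix n n ℂ))ᴴ *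
      (K - (K.trace / Fintype.card n) • (1 : Matrix n n ℂ))).trace =
      Fintype.card n * (Kᴴ * K).trace - K.trace * star K.trace := by
    simp [sub_mul, mul_sub, Matrix.trace_conjTranspose, Matrix.trace_sub]
    field_simp
  have := congrArg Complex.re key
  rw [Complex.star_def, Complex.mul_conj, Complex.normSq_eq_norm_sq] at this
  rw [frobenius_norm_sq_eq_re_trace, frobenius_norm_sq_eq_re_trace]
  simpa only [Complex.sub_re, Complex.ofReal_re, ← Complex.ofReal_natCast,
    Complex.re_ofReal_mul] using this

/-- The quadratic form of a dissipator is bounded below by its trace: the factor on the left-hand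
side is the trace of `X ↦ dissipator K X` as a linear map. -/
theorem re_trace_dissipator_ge (hn : 2 ≤ Fintype.card n) (K X : Matrix n n ℂ) :
    (‖K.trace‖ ^ 2 - Fintype.card n * ‖K‖ ^ 2) * ‖X‖ ^ 2 ≤ (Xᴴ * dissipator K X).trace.re := by
  have : Nonempty n := Fintype.card_pos_iff.mp (by omega)
  set c := K.trace / Fintype.card n
  have h := neg_two_mul_le_re_trace_dissipator (K - c • 1) X
  rw [← re_trace_dissipator_add_smul_one _ _ c, sub_add_cancel] at h
  have hc := card_mul_norm_sub_smul_one_sq K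
  have hn' : (2 : ℝ) ≤ Fintype.card n := by exact_mod_cast hn
  refine le_trans ?_ h
  rw [← neg_sub, ← hc, neg_mul, neg_le_neg_iff]
  gcongr

end Lindblad

/-! ### Infinitesimal Markovian divisible channels -/

section Channels

open scoped Matrix.Norms.Frobenius

variable {d : ℕ}

theorem superOpMatrix_apply (T : SuperOp d) (p q : Fin d × Fin d) :
    superOpMatrix T p q = T (Matrix.single q.1 q.2 1) p.1 p.2 := by
  rw [superOpMatrix, LinearMap.toMatrix_apply, ← Matrix.stdBasis_eq_single]
  rfl

theorem superOpMatrix_mulVec (T : SuperOp d) (v : Fin d × Fin d → ℂ) (p : Fin d × Fin d) :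
    (superOpMatrix T *ᵥ v) p = T (Matrix.of fun i j => v (i, j)) p.1 p.2 :=
  congrFun (LinearMap.toMatrix_mulVec_repr (Matrix.stdBasis ℂ (Fin d) (Fin d))
    (Matrix.stdBasis ℂ (Fin d) (Fin d)) T (Matrix.of fun i j => v (i, j))) p

theorem inner_toEuclideanCLM_superOpMatrix (T : SuperOp d)
    (v : EuclideanSpace ℂ (Fin d × Fin d)) :
    inner ℂ v (Matrix.toEuclideanCLM (n := Fin d × Fin d) (𝕜 := ℂ) (superOpMatrix T) v) =
      ((Matrix.of fun i j => v (i, j))ᴴ * T (Matrix.of fun i j => v (i, j))).trace := by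
  rw [PiLp.inner_apply, Matrix.trace, Fintype.sum_prod_type, Finset.sum_comm]
  refine Finset.sum_congr rfl fun j _ => ?_
  rw [Matrix.diag_apply, Matrix.mul_apply]
  refine Finset.sum_congr rfl fun i _ => ?_
  rw [Matrix.ofLp_toEuclideanCLM, superOpMatrix_mulVec]
  simp [mul_comm]

theorem frobenius_norm_of_euclidean (v : EuclideanSpace ℂ (Fin d × Fin d)) :
    ‖(Matrix.of fun i j => v (i, j) : Matrix (Fin d) (Fin d) ℂ)‖ ^ 2 = ‖v‖ ^ 2 := by
  rw [Matrix.frobenius_norm_def, ← Real.sqrt_eq_rpow, Real.sq_sqrt (by positivity),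
    EuclideanSpace.norm_sq_eq, Fintype.sum_prod_type]
  simp

theorem re_trace_superOpMatrix_lindblad {L : SuperOp d} {H : Matrix (Fin d) (Fin d) ℂ} {m : ℕ}
    {K : Fin m → Matrix (Fin d) (Fin d) ℂ}
    (hL : ∀ ρ, L ρ = Complex.I • (ρ * H - H * ρ) + ∑ j, dissipator (K j) ρ) :
    (superOpMatrix L).trace.re = ∑ j, (‖(K j).trace‖ ^ 2 - d * ‖K j‖ ^ 2) := by
  have hAB (A B : Matrix (Fin d) (Fin d) ℂ) :
      ∑ i : Fin d, ∑ j : Fin d, (A * Matrix.single i j (1 : ℂ) * B) i j = A.trace * B.trace := by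
    simp [Matrix.trace, Finset.sum_mul_sum, Matrix.mul_apply, Matrix.single_apply, ite_and]
  have hA (A : Matrix (Fin d) (Fin d) ℂ) :
      ∑ i : Fin d, ∑ j : Fin d, (A * Matrix.single i j (1 : ℂ)) i j = d * A.trace := by
    simpa [mul_comm] using hAB A 1
  have hB (B : Matrix (Fin d) (Fin d) ℂ) :
      ∑ i : Fin d, ∑ j : Fin d, (Matrix.single i j (1 : ℂ) * B) i j = d * B.trace := by
    simpa using hAB 1 B
  have hD (K : Matrix (Fin d) (Fin d) ℂ) :
      ∑ i : Fin d, ∑ j : Fin d, dissipator K (Matrix.single i j (1 : ℂ)) i j =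
        K.trace * star K.trace - d * (Kᴴ * K).trace := by
    simp only [dissipator, Matrix.sub_apply, Matrix.smul_apply, Matrix.add_apply,
      Finset.sum_sub_distrib, ← Finset.mul_sum, Finset.sum_add_distrib, hAB, hA, hB,
      Matrix.trace_conjTranspose, smul_eq_mul]
    ring
  have htr : (superOpMatrix L).trace =
      ∑ j, ((K j).trace * star (K j).trace - d * ((K j)ᴴ * K j).trace) := by
    simp only [← hD]
    rw [Matrix.trace, Fintype.sum_prod_type]
    simp only [Matrix.diag_apply, superOpMatrix_apply, hL, Matrix.add_apply, Matrix.smul_apply,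
      Matrix.sub_apply, Matrix.sum_apply, Finset.sum_add_distrib, ← Finset.smul_sum,
      Finset.sum_sub_distrib, hA, hB, sub_self, smul_zero, zero_add]
    rw [Finset.sum_comm]
    conv_rhs => rw [Finset.sum_comm]
    conv_rhs => enter [2, i]; rw [Finset.sum_comm]
    rw [Finset.sum_comm]
  rw [htr, Complex.re_sum]
  refine Finset.sum_congr rfl fun j _ => ?_
  rw [frobenius_norm_sq_eq_re_trace, Complex.sub_re, Complex.star_def, Complex.mul_conj,
    Complex.normSq_eq_norm_sq, Complex.ofReal_re, ← Complex.ofReal_natCast, Complex.re_ofReal_mul]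

/-- A Hamiltonian contributes an anti-Hermitian map, whose quadratic form is imaginary. -/
theorem re_trace_hamiltonian {H : Matrix (Fin d) (Fin d) ℂ} (hH : H.IsHermitian)
    (X : Matrix (Fin d) (Fin d) ℂ) :
    (Xᴴ * (Complex.I • (X * H - H * X))).trace.re = 0 := by
  have h := re_trace_conjTranspose (Xᴴ * (Complex.I • (X * H - H * X)))
  have h' : (Xᴴ * (Complex.I • (X * H - H * X)))ᴴ.trace =
      -(Xᴴ * (Complex.I • (X * H - H * X))).trace := by
    simp only [Matrix.conjTranspose_mul, Matrix.conjTranspose_smul, Matrix.conjTranspose_sub,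
      Matrix.conjTranspose_conjTranspose, hH.eq, Complex.star_def, Complex.conj_I,
      mul_smul_comm, Matrix.trace_smul, mul_sub, Matrix.trace_sub, neg_smul,
      Matrix.trace_neg]
    rw [mul_assoc H, Matrix.trace_mul_comm H]
    simp only [mul_assoc]
  rw [h', Complex.neg_re] at h
  linarith

theorem detLeMinStretch_exp_lindblad (hd : 2 ≤ d) {L : SuperOp d} (hL : IsLindbladGenerator L) :
    DetLeMinStretch (NormedSpace.exp (superOpMatrix L)) := by
  obtain ⟨H, hH, m, K, hK⟩ := hL
  have hK' : ∀ ρ, L ρ = Complex.I • (ρ * H - H * ρ) + ∑ j, dissipator (K j) ρ := hK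
  intro v
  have hdet : ‖(NormedSpace.exp (superOpMatrix L)).det‖ =
      Real.exp (superOpMatrix L).trace.re := by
    rw [det_exp, ← Complex.exp_eq_exp_ℂ, Complex.norm_exp]
  have hexp : Matrix.toEuclideanLin (NormedSpace.exp (superOpMatrix L)) v =
      NormedSpace.exp (Matrix.toEuclideanCLM (n := Fin d × Fin d) (𝕜 := ℂ) (superOpMatrix L)) v := by
    open scoped Matrix.Norms.L2Operator in
    rw [← NormedSpace.map_exp_of_mem_ball (𝕂 := ℂ)
      (Matrix.toEuclideanCLM (n := Fin d × Fin d) (𝕜 := ℂ))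
      (LinearMap.continuous_of_finiteDimensional
        (Matrix.toEuclideanCLM (n := Fin d × Fin d) (𝕜 := ℂ)).toAlgEquiv.toLinearMap) _
      ((NormedSpace.expSeries_radius_eq_top ℂ
        (Matrix (Fin d × Fin d) (Fin d × Fin d) ℂ)).symm ▸ edist_lt_top _ _)]
    rfl
  rw [hdet, hexp]
  refine exp_mul_norm_le_norm_exp_apply _ _ (fun w => ?_) v
  rw [inner_toEuclideanCLM_superOpMatrix, re_trace_superOpMatrix_lindblad hK', hK', mul_add,
    Matrix.trace_add, Complex.add_re, re_trace_hamiltonian hH, zero_add, Finset.mul_sum,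
    Matrix.trace_sum, Complex.re_sum, Finset.sum_mul, ← frobenius_norm_of_euclidean]
  refine Finset.sum_le_sum fun j _ => ?_
  simpa using re_trace_dissipator_ge (by simpa using hd) (K j) (Matrix.of fun i j => w (i, j))

theorem IsInfinitesimalDivisibleChannel.detLeMinStretch (hd : 2 ≤ d) {T : SuperOp d}
    (hT : IsInfinitesimalDivisibleChannel T) : DetLeMinStretch (superOpMatrix T) := by
  refine closure_minimal (fun A hA => ?_) isClosed_setOf_detLeMinStretch hT
  -- The inequality holds for each `e^L`, however large `L` is, so that any `ε` will do.
  obtain ⟨l, hl, rfl⟩ := hA 1 one_pos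
  refine detLeMinStretch_list_prod _ fun B hB => ?_
  obtain ⟨G, hG, rfl⟩ := List.mem_map.mp hB
  obtain ⟨L, hL, rfl⟩ := (hl G hG).1
  exact detLeMinStretch_exp_lindblad hd hL

end Channels

/-! ### A stochastic matrix violating the inequality -/

section Stochastic

variable {n : Type*} [Fintype n] [DecidableEq n]

/-- A cone of generators contains the roots `Q / N` of each of its members, so that it generates
the exponentials of its members infinitesimally. -/
theorem isInfinitesimalMarkovianDivisible_exp {𝕜 : Type*} [RCLike 𝕜] {𝒢 : Set (Matrix n n 𝕜)}
    {Q : Matrix n n 𝕜} (hQ : ∀ N : ℕ, ((N : 𝕜)⁻¹) • Q ∈ 𝒢) :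
    IsInfinitesimalMarkovianDivisible 𝒢 (NormedSpace.exp Q) := by
  refine subset_closure fun ε hε => ?_
  have hlim : Filter.Tendsto (fun N : ℕ => ‖Matrix.toEuclideanCLM (n := n) (𝕜 := 𝕜)
      (NormedSpace.exp (((N : 𝕜)⁻¹) • Q) - 1)‖) Filter.atTop (nhds 0) := by
    open scoped Matrix.Norms.L2Operator in
    have hc : Continuous fun t : 𝕜 => ‖Matrix.toEuclideanCLM (n := n) (𝕜 := 𝕜)
        (NormedSpace.exp (t • Q) - 1)‖ := by
      have h1 : Continuous (Matrix.toEuclideanCLM (n := n) (𝕜 := 𝕜)) :=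
        LinearMap.continuous_of_finiteDimensional
          (Matrix.toEuclideanCLM (n := n) (𝕜 := 𝕜)).toAlgEquiv.toLinearMap
      exact (h1.comp ((differentiable_exp_smul_const 𝕜 Q).continuous.sub
        continuous_const)).norm
    have hz : ‖Matrix.toEuclideanCLM (n := n) (𝕜 := 𝕜)
        (NormedSpace.exp ((0 : 𝕜) • Q) - 1)‖ = 0 := by simp
    rw [← hz]
    exact (hc.tendsto 0).comp tendsto_inv_atTop_nhds_zero_nat
  obtain ⟨N, hN, hN0⟩ :=
    ((hlim.eventually (ge_mem_nhds hε)).and (Filter.eventually_gt_atTop 0)).exists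
  refine ⟨List.replicate N (((N : 𝕜)⁻¹) • Q), fun G hG => ?_, ?_⟩
  · rw [List.eq_of_mem_replicate hG]
    exact ⟨hQ N, hN⟩
  · rw [List.map_replicate, List.prod_replicate, ← Matrix.exp_nsmul, ← Nat.cast_smul_eq_nsmul 𝕜,
      smul_smul, mul_inv_cancel₀ (by exact_mod_cast hN0.ne'), one_smul]

/-- The projection `E_aa - E_ab`; its negative generates the jump process from `a` to `b`. -/
def jumpProjection (a b : n) : Matrix n n ℝ :=
  Matrix.single a a 1 - Matrix.single a b 1

variable {a b : n}

theorem isIdempotentElem_jumpProjection (hab : a ≠ b) : IsIdempotentElem (jumpProjection a b) := by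
  simp [IsIdempotentElem, jumpProjection, mul_sub, sub_mul, hab.symm]

/-- The stochastic matrix of a jump from `a` to `b` with probability `1 / 2`. -/
noncomputable def halfJump (a b : n) : Matrix n n ℝ :=
  1 - (1 / 2 : ℝ) • jumpProjection a b

theorem exp_jumpProjection (hab : a ≠ b) :
    NormedSpace.exp ((-Real.log 2) • jumpProjection a b) = halfJump a b := by
  rw [exp_smul_of_isIdempotentElem (isIdempotentElem_jumpProjection hab), ← Real.exp_eq_exp_ℝ,
    Real.exp_neg, Real.exp_log two_pos, halfJump]
  module

theorem halfJump_mem_rowStochastic (hab : a ≠ b) : halfJump a b ∈ Matrix.rowStochastic ℝ n := by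
  rw [Matrix.mem_rowStochastic_iff_sum]
  refine ⟨fun i j => ?_, fun i => ?_⟩
  · simp only [halfJump, jumpProjection, Matrix.sub_apply, Matrix.smul_apply, Matrix.one_apply,
      Matrix.single_apply, smul_eq_mul]
    split_ifs <;> grind
  · simp [halfJump, jumpProjection, Finset.sum_sub_distrib, Matrix.one_apply, Matrix.single_apply,
      ← Finset.mul_sum, ite_and]

theorem isInfinitesimalDivisibleStochastic_halfJump (hab : a ≠ b) :
    IsInfinitesimalDivisibleStochastic (halfJump a b) := by
  rw [← exp_jumpProjection hab]
  refine isInfinitesimalMarkovianDivisible_exp fun N => ?_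
  have hc : 0 ≤ (N : ℝ)⁻¹ * Real.log 2 := mul_nonneg (by positivity) (Real.log_nonneg one_le_two)
  rw [smul_smul, mul_neg]
  generalize (N : ℝ)⁻¹ * Real.log 2 = c at hc
  refine ⟨fun i j hij => ?_, fun i => ?_⟩
  · simp only [jumpProjection, Matrix.sub_apply, Matrix.smul_apply, Matrix.single_apply,
      smul_eq_mul]
    split_ifs <;> grind
  · simp [jumpProjection, Finset.sum_sub_distrib, Matrix.single_apply, ← Finset.mul_sum, ite_and]

theorem det_halfJump (hab : a ≠ b) : (halfJump a b).det = 1 / 2 := by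
  rw [← exp_jumpProjection hab, det_exp, ← Real.exp_eq_exp_ℝ]
  have : (jumpProjection a b).trace = 1 := by
    simp [jumpProjection, Matrix.trace_sub, Matrix.trace_single_eq_of_ne, hab]
  rw [Matrix.trace_smul, this, smul_eq_mul, mul_one, Real.exp_neg, Real.exp_log two_pos, one_div]

theorem not_detLeMinStretch_halfJump (hab : a ≠ b) : ¬ DetLeMinStretch (halfJump a b) := by
  intro h
  -- `e_a` is stretched by exactly the factor `1 / 2`, the determinant, but is not a right singular
  -- vector: tilting it towards `-e_b` decreases the stretch to first order.
  have h1 := h (EuclideanSpace.single a 1 - EuclideanSpace.single b (1 / 4))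
  have hS : Matrix.toEuclideanLin (halfJump a b)
      (EuclideanSpace.single a 1 - EuclideanSpace.single b (1 / 4)) =
      EuclideanSpace.single a (3 / 8) - EuclideanSpace.single b (1 / 4) := by
    ext i
    simp [halfJump, jumpProjection, Matrix.toLpLin_apply, Matrix.mulVec_sub, hab, hab.symm,
      Matrix.single_apply]
    split_ifs <;> grind
  have hnorm (x y : ℝ) :
      ‖(EuclideanSpace.single a x - EuclideanSpace.single b y : EuclideanSpace ℝ n)‖ ^ 2 =
        x ^ 2 + y ^ 2 := by
    rw [norm_sub_sq_real]
    simp [EuclideanSpace.inner_single_left, hab]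
  rw [hS, det_halfJump hab] at h1
  have h2 := pow_le_pow_left₀ (by positivity) h1 2
  rw [mul_pow, hnorm, hnorm] at h2
  norm_num at h2

end Stochastic

end MarkovDiv

theorem corollary4p17 (d : ℕ) (hd : 2 ≤ d) :
    ¬ ∃ f : Matrix.rowStochastic ℝ (Fin (d ^ 2)) → MarkovDiv.quantumChannels d,
      (∀ S : Matrix.rowStochastic ℝ (Fin (d ^ 2)),
        MarkovDiv.IsInfinitesimalDivisibleStochastic (S : Matrix (Fin (d ^ 2)) (Fin (d ^ 2)) ℝ) →
          MarkovDiv.IsInfinitesimalDivisibleChannel (f S : MarkovDiv.SuperOp d)) ∧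
      (∀ S : Matrix.rowStochastic ℝ (Fin (d ^ 2)),
        MarkovDiv.superOpSingularValues (f S : MarkovDiv.SuperOp d) =
          MarkovDiv.matrixSingularValues (S : Matrix (Fin (d ^ 2)) (Fin (d ^ 2)) ℝ)) := by
  rintro ⟨f, hdiv, hsing⟩
  have hd2 : 1 < d ^ 2 := Nat.one_lt_pow two_ne_zero hd
  let a : Fin (d ^ 2) := ⟨0, by omega⟩
  let b : Fin (d ^ 2) := ⟨1, hd2⟩
  have hab : a ≠ b := by simp [a, b]
  let S : Matrix.rowStochastic ℝ (Fin (d ^ 2)) :=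
    ⟨MarkovDiv.halfJump a b, MarkovDiv.halfJump_mem_rowStochastic hab⟩
  have hchannel := (hdiv S
    (MarkovDiv.isInfinitesimalDivisibleStochastic_halfJump hab)).detLeMinStretch hd
  have hcard : Fintype.card (Fin d × Fin d) = Fintype.card (Fin (d ^ 2)) := by simp [sq]
  refine MarkovDiv.not_detLeMinStretch_halfJump hab ((MarkovDiv.detLeMinStretch_iff _).mpr ?_)
  have hS := hsing S
  rw [MarkovDiv.superOpSingularValues] at hS
  rw [MarkovDiv.detLeMinStretch_iff, hcard, hS] at hchannel
  exact hchannel
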